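/- **Setting.** Let $d\in\{2,3\}$, $\Omega=(0,1)^d$ (so $|\Omega|=1$), $N=2K+1$ with $K\in\mathbb N$, $h=1/N$, and let $\mathcal G_N$ be the space of real $N$-periodic grid functions $f_x$ on $\{0,\dots,N-1\}^d$. For $f,g\in\mathcal G_N$ put $\langle f,g\rangle=h^d\sum_x f_xg_x$, $\|f\|_2=\langle f,f\rangle^{1/2}$, $\|f\|_p=(h^d\sum_x|f_x|^p)^{1/p}$, and $\hat f_k=h^d\sum_x f_x e^{-2\pi i h\,k\cdot x}$ for $k\in\{-K,\dots,K\}^d$, so that $f_x=\sum_k\hat f_k e^{2\pi i h\,k\cdot x}$. Let $\mathcal D_j$ and $\mathcal D_j^2$ be the Fourier multipliers with symbols $2\pi i k_j$ and $-4\pi^2k_j^2$, and let $\nabla_Nf=(\mathcal D_jf)_j$, $\nabla_N\cdot F=\sum_j\mathcal D_jF_j$, $\Delta_N=\sum_j\mathcal D_j^2$; $\|\nabla_Nf\|_p$ is the $\ell^p$ norm of the pointwise Euclidean length $|\nabla_Nf|$. For $a>0$ let $L_N=a+\Delta_N^2$, and let $L_N^{1/2}$ be the multiplier with symbol $(a+\lambda_k^2)^{1/2}$,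 $\lambda_k=4\pi^2|k|^2$. Define $$E_N(\phi)=\tfrac14\|\nabla_N\phi\|_4^4+\tfrac a2\|\phi\|_2^2-\|\nabla_N\phi\|_2^2+\tfrac12\|\Delta_N\phi\|_2^2,$$ $$E_{1,N}(\phi)=\tfrac14\|\nabla_N\phi\|_4^4-\|\nabla_N\phi\|_2^2+2|\Omega|,\qquad N_N(\phi)=-\nabla_N\cdot(|\nabla_N\phi|^2\nabla_N\phi)+2\Delta_N\phi .$$ For a time step $\Delta t>0$, the SAV scheme determines $(\phi^{n+1},r^{n+1})\in\mathcal G_N\times\mathbb R$, $n\ge0$, from starting values $\phi^{-1},\phi^0\in\mathcal G_N$, $r^{-1},r^0\in\mathbb R$ by $$\frac{\frac32\phi^{n+1}-2\phi^n+\frac12\phi^{n-1}}{\Delta t}=\Delta_N\Big(\frac{r^{n+1}}{\sqrt{E_{1,N}(\hat\phi^{n+1})}}N_N(\hat\phi^{n+1})+L_N\phi^{n+1}\Big),$$ $$\frac{\frac32r^{n+1}-2r^n+\frac12r^{n-1}}{\Delta t}=\frac1{2\sqrt{E_{1,N}(\hat\phi^{n+1})}}\Big\langle N_N(\hat\phi^{n+1}),\frac{\frac32\phi^{n+1}-2\phi^n+\frac12\phi^{n-1}}{\Delta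 t}\Big\rangle,\qquad \hat\phi^{n+1}=2\phi^n-\phi^{n-1}.$$ **Proposition.** For every $\tilde C_0\in\mathbb R$ there is a constant $\tilde C_1^*>0$, depending only on $\Omega$ and $\tilde C_0$ (in particular not on $a$, $h$, $\Delta t$, the starting values or the time level), such that the following holds. Let $a>0$, $K\in\mathbb N$, $\Delta t>0$, and let $(\phi^n,r^n)_{n\ge-1}$ satisfy the scheme for all $n\ge0$, with arbitrary starting values $\phi^{-1},\phi^0,r^{-1},r^0$ (for instance $\phi^{-1}=\phi^0-\Delta t\,\Delta_N\big(N_N(\phi^0)+L_N\phi^0\big)$, $r^0=\sqrt{E_{1,N}(\phi^0)}$, $r^{-1}=\sqrt{E_{1,N}(\phi^{-1})}$) that satisfy $$\tfrac14\big(\|L_N^{1/2}\phi^0\|_2^2+\|L_N^{1/2}(2\phi^0-\phi^{-1})\|_2^2\big)+\tfrac12\big(|r^0|^2+|2r^0-r^{-1}|^2\big)\le\tilde C_0 .$$ Then $E_N(\phi^m)\le\tilde C_1^*$ for all $m\ge1$. -/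

import Mathlib

open scoped BigOperators

noncomputable section

namespace SPFC

/-- Real grid functions that are periodic on the uniform grid of the unit cube `Ω = (0,1)^d`, with
`N = 2K+1` points in every direction: the multi-index `x` labels the grid point `(x_j h)_j`. -/
abbrev GridFn (d K : ℕ) : Type := (Fin d → ZMod (2 * K + 1)) → ℝ

/-- The mesh size `h = 1/N`, `N = 2K+1`. -/
def mesh (K : ℕ) : ℝ := 1 / (2 * (K : ℝ) + 1)

/-- The frequencies `k ∈ ℤ^d` with `-K ≤ k_j ≤ K`. -/
def freqs (d K : ℕ) : Finset (Fin d → ℤ) :=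
  Fintype.piFinset fun _ => Finset.Icc (-(K : ℤ)) (K : ℤ)

/-- `k · x = ∑ j, k_j x_j h`, the frequency `k` paired with the grid point of multi-index `x`. -/
def phase {d K : ℕ} (k : Fin d → ℤ) (x : Fin d → ZMod (2 * K + 1)) : ℝ :=
  ∑ j, (k j : ℝ) * (((x j).val : ℝ) * mesh K)

/-- The discrete Fourier coefficient `h^d ∑_x f_x exp(-2πi k·x)`. -/
def fourierCoeff {d K : ℕ} (f : GridFn d K) (k : Fin d → ℤ) : ℂ :=
  ((mesh K : ℝ) : ℂ) ^ d *
    ∑ x, (f x : ℂ) * Complex.exp (-(2 * Real.pi * Complex.I * (phase k x : ℂ)))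

/-- The sum `∑_k σ(k) f̂_k exp(2πi k·x)` over the frequencies of the grid. -/
def multiplierSum {d K : ℕ} (σ : (Fin d → ℤ) → ℂ) (f : GridFn d K)
    (x : Fin d → ZMod (2 * K + 1)) : ℂ :=
  ∑ k ∈ freqs d K, σ k * fourierCoeff f k *
    Complex.exp (2 * Real.pi * Complex.I * (phase k x : ℂ))

/-- The Fourier multiplier with symbol `σ`, acting on real grid functions. For a symbol with
`σ(-k) = conj σ(k)`, as all the ones below, the sum is real (see `multiplierSum_im`), so that
taking the real part changes nothing. -/
def multiplier {d K : ℕ} (σ : (Fin d → ℤ) → ℂ) (f : GridFn d K) : GridFn d K :=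
  fun x => (multiplierSum σ f x).re

theorem multiplierSum_im {d K : ℕ} (σ : (Fin d → ℤ) → ℂ)
    (hσ : ∀ k, σ (-k) = (starRingEnd ℂ) (σ k)) (f : GridFn d K)
    (x : Fin d → ZMod (2 * K + 1)) : (multiplierSum σ f x).im = 0 := by
  rw [← Complex.conj_eq_iff_im]
  unfold multiplierSum
  rw [map_sum]
  have hphase : ∀ (k : Fin d → ℤ) (y : Fin d → ZMod (2 * K + 1)), phase (-k) y = -phase k y := by
    intro k y
    simp [phase, Finset.sum_neg_distrib]
  refine Finset.sum_bij' (fun k _ => -k) (fun k _ => -k) ?_ ?_ ?_ ?_ ?_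
  · intro k hk
    simp only [freqs, Fintype.mem_piFinset, Finset.mem_Icc, Pi.neg_apply] at hk ⊢
    intro j
    have := hk j
    omega
  · intro k hk
    simp only [freqs, Fintype.mem_piFinset, Finset.mem_Icc, Pi.neg_apply] at hk ⊢
    intro j
    have := hk j
    omega
  · intro k _
    exact neg_neg k
  · intro k _
    exact neg_neg k
  · intro k _
    have hc : fourierCoeff f (-k) = (starRingEnd ℂ) (fourierCoeff f k) := by
      simp [fourierCoeff, map_sum, map_ofNat, hphase, ← Complex.exp_conj]
    rw [hσ, hc, hphase]
    simp [map_ofNat, ← Complex.exp_conj]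

/-- The collocation spectral derivative in the direction `j`, with symbol `2πi k_j`. -/
def D {d K : ℕ} (j : Fin d) : GridFn d K → GridFn d K :=
  multiplier fun k => 2 * Real.pi * Complex.I * (k j : ℂ)

/-- The collocation spectral second derivative in the direction `j`, with symbol `-4π² k_j²`. -/
def D2 {d K : ℕ} (j : Fin d) : GridFn d K → GridFn d K :=
  multiplier fun k => -(4 * (Real.pi : ℂ) ^ 2 * (k j : ℂ) ^ 2)

/-- The discrete Laplacian `Δ_N`. -/
def lap {d K : ℕ} (f : GridFn d K) : GridFn d K := ∑ j, D2 j f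

/-- The discrete gradient `∇_N`, as the family of its components. -/
def grad {d K : ℕ} (f : GridFn d K) : Fin d → GridFn d K := fun j => D j f

/-- The discrete divergence `∇_N ·`. -/
def div {d K : ℕ} (F : Fin d → GridFn d K) : GridFn d K := ∑ j, D j (F j)

/-- The pointwise Euclidean length `|∇_N f|`. -/
def gradLen {d K : ℕ} (f : GridFn d K) : GridFn d K :=
  fun x => Real.sqrt (∑ j, grad f j x ^ 2)

/-- The eigenvalue `λ_k = 4π² |k|²` of `-Δ_N`. -/
def eig {d : ℕ} (k : Fin d → ℤ) : ℝ := 4 * Real.pi ^ 2 * ∑ j, (k j : ℝ) ^ 2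

/-- `L_N f = a f + Δ_N² f`. -/
def L {d K : ℕ} (a : ℝ) (f : GridFn d K) : GridFn d K := a • f + lap (lap f)

/-- `L_N^{1/2}`, the multiplier with symbol `(a + λ_k²)^{1/2}`. -/
def sqrtL {d K : ℕ} (a : ℝ) : GridFn d K → GridFn d K :=
  multiplier fun k => ((Real.sqrt (a + eig k ^ 2) : ℝ) : ℂ)

/-- The discrete inner product `⟨f, g⟩ = h^d ∑_x f_x g_x`. -/
def ip {d K : ℕ} (f g : GridFn d K) : ℝ := mesh K ^ d * ∑ x, f x * g x

/-- `‖f‖_2 = ⟨f, f⟩^{1/2}`. -/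
def norm2 {d K : ℕ} (f : GridFn d K) : ℝ := Real.sqrt (ip f f)

/-- `‖f‖_p = (h^d ∑_x |f_x|^p)^{1/p}`, for `1 ≤ p < ∞`. -/
def normP {d K : ℕ} (p : ℝ) (f : GridFn d K) : ℝ :=
  (mesh K ^ d * ∑ x, |f x| ^ p) ^ (1 / p)

/-- The discrete SPFC energy
`E_N(φ) = ¼‖∇_N φ‖_4^4 + (a/2)‖φ‖_2² - ‖∇_N φ‖_2² + ½‖Δ_N φ‖_2²`. -/
def energy {d K : ℕ} (a : ℝ) (φ : GridFn d K) : ℝ :=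
  1 / 4 * normP 4 (gradLen φ) ^ 4 + a / 2 * norm2 φ ^ 2 - norm2 (gradLen φ) ^ 2
    + 1 / 2 * norm2 (lap φ) ^ 2

/-- The discrete nonlinear energy `E_{1,N}(φ) = ¼‖∇_N φ‖_4^4 - ‖∇_N φ‖_2² + 2|Ω|`, where `|Ω| = 1`
is the volume of the unit cube. -/
def nonlinEnergy {d K : ℕ} (φ : GridFn d K) : ℝ :=
  1 / 4 * normP 4 (gradLen φ) ^ 4 - norm2 (gradLen φ) ^ 2 + 2 * 1

/-- The discrete nonlinear chemical potential `N_N(φ) = -∇_N·(|∇_N φ|² ∇_N φ) + 2Δ_N φ`. -/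
def nonlinPot {d K : ℕ} (φ : GridFn d K) : GridFn d K :=
  -div (fun j => fun x => gradLen φ x ^ 2 * grad φ j x) + (2 : ℝ) • lap φ

/-- The BDF2 difference `(3/2) u^{n+1} - 2 u^n + (1/2) u^{n-1}`. -/
def bdf {V : Type*} [AddCommGroup V] [Module ℝ V] (u : ℤ → V) (n : ℤ) : V :=
  (3 / 2 : ℝ) • u (n + 1) - (2 : ℝ) • u n + (1 / 2 : ℝ) • u (n - 1)

/-- The second order extrapolation, giving `2 u^n - u^{n-1}` as a prediction of `u^{n+1}`. -/
def extrap {V : Type*} [AddCommGroup V] [Module ℝ V] (u : ℤ → V) (n : ℤ) : V :=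
  (2 : ℝ) • u n - u (n - 1)

/-- `(φ^n, r^n)`, `n ≥ -1`, is a numerical solution of the fully discrete BDF2 SAV scheme with time
step `dt`: both equations hold for every `n ≥ 0`. (The values for `n < -1` play no role.) -/
structure IsSAVSolution {d K : ℕ} (a dt : ℝ) (φ : ℤ → GridFn d K) (r : ℤ → ℝ) : Prop where
  phi_step : ∀ n : ℤ, 0 ≤ n →
    (1 / dt) • bdf φ n =
      lap ((r (n + 1) / Real.sqrt (nonlinEnergy (extrap φ n))) • nonlinPot (extrap φ n)
        + L a (φ (n + 1)))
  r_step : ∀ n : ℤ, 0 ≤ n →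
    (1 / dt) * bdf r n =
      1 / (2 * Real.sqrt (nonlinEnergy (extrap φ n))) *
        ip (nonlinPot (extrap φ n)) ((1 / dt) • bdf φ n)

/-- The discrete modified energy at two consecutive levels,
`¼(‖L_N^{1/2} φ‖_2² + ‖L_N^{1/2}(2φ - ψ)‖_2²) + ½(|r|² + |2r - s|²)`,
with `φ, r` at the newer and `ψ, s` at the older level. -/
def modifiedEnergy {d K : ℕ} (a : ℝ) (φ ψ : GridFn d K) (r s : ℝ) : ℝ :=
  1 / 4 * (norm2 (sqrtL a φ) ^ 2 + norm2 (sqrtL a ((2 : ℝ) • φ - ψ)) ^ 2)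
    + 1 / 2 * (|r| ^ 2 + |2 * r - s| ^ 2)

end SPFC

end

noncomputable section

namespace SPFC

open ComplexConjugate

variable {d K : ℕ}

/-! Test the first equation with the chemical potential `μ` (the argument of `Δ_N`) and the second
with `2 r^{n+1}`. The nonlinear terms cancel, `⟨Δ_N μ, μ⟩ ≤ 0`, and the BDF2 difference tested with
the newest value is a discrete derivative plus a square; hence `modifiedEnergy` never increases
(`IsSAVSolution.modifiedEnergy_step`). This gives `a‖φ^m‖² + ‖Δ_N φ^m‖² ≤ 4C₀`, which bounds the
quadratic part of the energy.

The quartic term needs a discrete embedding of `H¹` into `L⁴`, uniform in `K` (`ip_mul_self_le`).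
The Fourier coefficients of `f²` are a convolution of those of `f`; Cauchy–Schwarz with weights
`|k|²` reduces the claim to the boundedness of `∑ |k|⁻⁴`, true for `d < 4`. A spectral derivative
has mean zero, so `Δ_N` alone suffices and `a` does not enter the constant. -/

/-! ### Fourier analysis on the grid group and its dual. -/

/-- The character `x ↦ exp (2πi κ·x / N)` of the grid group, `N = 2K+1`. -/
def chi (κ x : Fin d → ZMod (2 * K + 1)) : ℂ := ∏ j, ZMod.stdAddChar (κ j * x j)

/-- The discrete Fourier transform, indexed by the dual group of the grid. -/
def dft (f : GridFn d K) (κ : Fin d → ZMod (2 * K + 1)) : ℂ :=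
  ((mesh K : ℝ) : ℂ) ^ d * ∑ x, (f x : ℂ) * chi (-κ) x

/-- The representative with entries in `{-K, …, K}` of a class of frequencies. -/
def rep (κ : Fin d → ZMod (2 * K + 1)) : Fin d → ℤ := fun j => (κ j).valMinAbs

theorem chi_comm (κ x : Fin d → ZMod (2 * K + 1)) : chi κ x = chi x κ := by
  simp [chi, mul_comm]

theorem chi_add (κ μ x : Fin d → ZMod (2 * K + 1)) : chi (κ + μ) x = chi κ x * chi μ x := by
  simp [chi, add_mul, AddChar.map_add_eq_mul, Finset.prod_mul_distrib]

theorem chi_add_right (κ x y : Fin d → ZMod (2 * K + 1)) :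
    chi κ (x + y) = chi κ x * chi κ y := by
  rw [chi_comm, chi_add, chi_comm x, chi_comm y]

theorem chi_neg_right (κ x : Fin d → ZMod (2 * K + 1)) : chi κ (-x) = chi (-κ) x := by
  simp [chi]

theorem conj_chi (κ x : Fin d → ZMod (2 * K + 1)) : conj (chi κ x) = chi (-κ) x := by
  simp [chi, AddChar.map_neg_eq_conj]

theorem sum_chi (κ : Fin d → ZMod (2 * K + 1)) :
    ∑ x, chi κ x = if κ = 0 then (2 * (K : ℂ) + 1) ^ d else 0 := by
  have h : ∑ x, chi κ x = ∏ j, ∑ y : ZMod (2 * K + 1), ZMod.stdAddChar (y * κ j) := by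
    rw [Finset.prod_univ_sum]
    simp [chi, mul_comm]
  rw [h]
  simp_rw [AddChar.sum_mulShift _ (ZMod.isPrimitive_stdAddChar (2 * K + 1))]
  split_ifs with h0
  · subst h0
    simp [ZMod.card]
  · obtain ⟨j, hj⟩ := Function.ne_iff.1 h0
    exact Finset.prod_eq_zero (Finset.mem_univ j) (by simp only [Pi.zero_apply] at hj; simp [hj])

theorem mesh_pos (K : ℕ) : 0 < mesh K := by
  unfold mesh; positivity

theorem mesh_pow_mul_sum_chi (κ : Fin d → ZMod (2 * K + 1)) :
    ((mesh K : ℝ) : ℂ) ^ d * ∑ x, chi κ x = if κ = 0 then 1 else 0 := by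
  rw [sum_chi]
  split_ifs
  · rw [← mul_pow]
    have : (2 * (K : ℂ) + 1) ≠ 0 := by
      exact_mod_cast (by positivity : (2 * (K : ℝ) + 1) ≠ 0)
    simp [mesh, this]
  · simp

theorem exp_phase (k : Fin d → ℤ) (x : Fin d → ZMod (2 * K + 1)) :
    Complex.exp (2 * Real.pi * Complex.I * (phase k x : ℂ)) =
      chi (fun j => (k j : ZMod (2 * K + 1))) x := by
  unfold phase chi
  push_cast
  rw [Finset.mul_sum, Complex.exp_sum]
  refine Finset.prod_congr rfl fun j _ => ?_
  have h : ((k j : ZMod (2 * K + 1)) * x j) =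
      ((k j * ((x j).val : ℤ) : ℤ) : ZMod (2 * K + 1)) := by simp
  rw [h, ZMod.stdAddChar_coe]
  congr 1
  simp only [mesh]
  push_cast
  ring

theorem fourierCoeff_eq (f : GridFn d K) (k : Fin d → ℤ) :
    fourierCoeff f k = dft f (fun j => (k j : ZMod (2 * K + 1))) := by
  unfold fourierCoeff dft
  congr 1
  refine Finset.sum_congr rfl fun x _ => ?_
  congr 1
  rw [← conj_chi, ← exp_phase, ← Complex.exp_conj]
  simp [map_ofNat]

theorem rep_mem_freqs (κ : Fin d → ZMod (2 * K + 1)) : rep κ ∈ freqs d K := by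
  simp only [freqs, Fintype.mem_piFinset, Finset.mem_Icc, rep]
  intro j
  have := ZMod.natAbs_valMinAbs_le (κ j)
  omega

theorem rep_intCast {k : Fin d → ℤ} (hk : k ∈ freqs d K) :
    rep (fun j => (k j : ZMod (2 * K + 1))) = k := by
  funext j
  simp only [freqs, Fintype.mem_piFinset, Finset.mem_Icc] at hk
  have := hk j
  simp only [rep]
  rw [ZMod.valMinAbs_spec]
  refine ⟨rfl, ?_⟩
  constructor <;> push_cast <;> omega

theorem intCast_rep (κ : Fin d → ZMod (2 * K + 1)) :
    (fun j => (rep κ j : ZMod (2 * K + 1))) = κ := by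
  funext j
  simp [rep]

theorem rep_zero : rep (0 : Fin d → ZMod (2 * K + 1)) = 0 := by
  funext j
  simp [rep]

/-- As `N` is odd, the box of frequencies is a full set of representatives of `(ℤ/N)^d`. On this
group sums are translation invariant, as the convolution estimates require. -/
theorem sum_freqs {M : Type*} [AddCommMonoid M] (F : (Fin d → ℤ) → M) :
    ∑ k ∈ freqs d K, F k = ∑ κ : Fin d → ZMod (2 * K + 1), F (rep κ) := by
  refine Finset.sum_bij' (fun k _ => fun j => (k j : ZMod (2 * K + 1))) (fun κ _ => rep κ)
    ?_ ?_ ?_ ?_ ?_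
  · intros; simp
  · intros; exact rep_mem_freqs _
  · intro k hk; exact rep_intCast hk
  · intro κ _; exact intCast_rep κ
  · intro k hk; rw [rep_intCast hk]

theorem multiplierSum_eq (σ : (Fin d → ℤ) → ℂ) (f : GridFn d K)
    (x : Fin d → ZMod (2 * K + 1)) :
    multiplierSum σ f x = ∑ κ, σ (rep κ) * dft f κ * chi κ x := by
  unfold multiplierSum
  rw [sum_freqs]
  refine Finset.sum_congr rfl fun κ _ => ?_
  rw [fourierCoeff_eq, exp_phase, intCast_rep]

theorem multiplier_ofReal {σ : (Fin d → ℤ) → ℂ} (hσ : ∀ k, σ (-k) = conj (σ k))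
    (f : GridFn d K) (x : Fin d → ZMod (2 * K + 1)) :
    (multiplier σ f x : ℂ) = ∑ κ, σ (rep κ) * dft f κ * chi κ x := by
  rw [← multiplierSum_eq]
  apply Complex.ext
  · simp [multiplier]
  · simp [multiplierSum_im σ hσ f x]

/-- The coefficients of a trigonometric sum are the Fourier coefficients of its values. -/
theorem dft_of_eq_sum {f : GridFn d K} {c : (Fin d → ZMod (2 * K + 1)) → ℂ}
    (h : ∀ x, (f x : ℂ) = ∑ κ, c κ * chi κ x) (μ : Fin d → ZMod (2 * K + 1)) :
    dft f μ = c μ := by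
  unfold dft
  simp_rw [h, Finset.sum_mul]
  rw [Finset.sum_comm, Finset.mul_sum]
  have : ∀ κ, ((mesh K : ℝ) : ℂ) ^ d * ∑ x, c κ * chi κ x * chi (-μ) x =
      if κ = μ then c κ else 0 := by
    intro κ
    simp_rw [mul_assoc, ← chi_add, ← Finset.mul_sum]
    rw [mul_left_comm, mesh_pow_mul_sum_chi]
    simp [add_neg_eq_zero]
  simp [this]

theorem dft_multiplier {σ : (Fin d → ℤ) → ℂ} (hσ : ∀ k, σ (-k) = conj (σ k))
    (f : GridFn d K) (κ : Fin d → ZMod (2 * K + 1)) :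
    dft (multiplier σ f) κ = σ (rep κ) * dft f κ :=
  dft_of_eq_sum (multiplier_ofReal hσ f) κ

theorem dft_inversion (f : GridFn d K) (x : Fin d → ZMod (2 * K + 1)) :
    (f x : ℂ) = ∑ κ, dft f κ * chi κ x := by
  unfold dft
  simp_rw [mul_assoc, Finset.sum_mul]
  rw [← Finset.mul_sum, Finset.sum_comm, Finset.mul_sum]
  have : ∀ y, ((mesh K : ℝ) : ℂ) ^ d * ∑ κ, (f y : ℂ) * chi (-κ) y * chi κ x =
      if y = x then (f y : ℂ) else 0 := by
    intro y
    have hc : ∀ κ, (f y : ℂ) * chi (-κ) y * chi κ x = f y * chi (x - y) κ := by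
      intro κ
      rw [← chi_neg_right, mul_assoc, ← chi_add_right, chi_comm]
      congr 2
      abel
    simp_rw [hc, ← Finset.mul_sum]
    rw [mul_left_comm, mesh_pow_mul_sum_chi]
    simp [sub_eq_zero, eq_comm]
  simp [this]

theorem dft_injective : Function.Injective (dft : GridFn d K → _) := by
  intro f g h
  funext x
  have := dft_inversion f x
  rw [h, ← dft_inversion g x] at this
  exact_mod_cast this

theorem dft_add (f g : GridFn d K) : dft (f + g) = dft f + dft g := by
  funext κ
  simp [dft, add_mul, Finset.sum_add_distrib, mul_add]

theorem dft_smul (c : ℝ) (f : GridFn d K) : dft (c • f) = (c : ℂ) • dft f := by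
  funext κ
  simp only [dft, Pi.smul_apply, smul_eq_mul, Complex.ofReal_mul, mul_assoc, ← Finset.mul_sum]
  ring

theorem dft_zero : dft (0 : GridFn d K) = 0 := by
  funext κ
  simp [dft]

theorem dft_sum {ι : Type*} (s : Finset ι) (f : ι → GridFn d K) :
    dft (∑ i ∈ s, f i) = ∑ i ∈ s, dft (f i) := by
  classical
  induction s using Finset.induction_on with
  | empty => simp [dft_zero]
  | insert i s hi ih => rw [Finset.sum_insert hi, Finset.sum_insert hi, dft_add, ih]

theorem conj_dft (f : GridFn d K) (κ : Fin d → ZMod (2 * K + 1)) :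
    conj (dft f κ) = ((mesh K : ℝ) : ℂ) ^ d * ∑ x, (f x : ℂ) * chi κ x := by
  simp [dft, conj_chi]

/-- The difference `κ - l` is taken modulo `N`, so aliasing is already built into the convolution.
-/
theorem dft_mul (f g : GridFn d K) (κ : Fin d → ZMod (2 * K + 1)) :
    dft (f * g) κ = ∑ l, dft f l * dft g (κ - l) := by
  conv_lhs => unfold dft
  simp only [Pi.mul_apply, Complex.ofReal_mul]
  simp_rw [dft_inversion f, Finset.sum_mul]
  rw [Finset.sum_comm, Finset.mul_sum]
  refine Finset.sum_congr rfl fun l _ => ?_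
  conv_rhs => rw [dft.eq_def g]
  have : ∀ x, dft f l * chi l x * (g x : ℂ) * chi (-κ) x =
      dft f l * ((g x : ℂ) * chi (-(κ - l)) x) := by
    intro x
    rw [show -(κ - l) = l + -κ by abel, chi_add]
    ring
  simp_rw [this, ← Finset.mul_sum]
  ring

theorem ip_eq_sum_dft (f g : GridFn d K) :
    (ip f g : ℂ) = ∑ κ, dft f κ * conj (dft g κ) := by
  simp_rw [conj_dft]
  unfold ip
  push_cast
  simp_rw [dft_inversion f, Finset.sum_mul]
  rw [Finset.sum_comm, Finset.mul_sum]
  refine Finset.sum_congr rfl fun κ _ => ?_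
  rw [mul_left_comm]
  congr 1
  rw [Finset.mul_sum]
  exact Finset.sum_congr rfl fun x _ => by ring

theorem ip_self_eq_sum_normSq (f : GridFn d K) : ip f f = ∑ κ, ‖dft f κ‖ ^ 2 := by
  have h := ip_eq_sum_dft f f
  simp_rw [Complex.mul_conj'] at h
  exact_mod_cast h

theorem dft_D (j : Fin d) (f : GridFn d K) (κ : Fin d → ZMod (2 * K + 1)) :
    dft (D j f) κ = 2 * Real.pi * Complex.I * (rep κ j : ℂ) * dft f κ :=
  dft_multiplier (by simp [map_ofNat]) f κ

theorem dft_lap (f : GridFn d K) (κ : Fin d → ZMod (2 * K + 1)) :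
    dft (lap f) κ = -(eig (rep κ) : ℂ) * dft f κ := by
  have h : ∀ j, dft (D2 j f) κ = -(4 * (Real.pi : ℂ) ^ 2 * (rep κ j : ℂ) ^ 2) * dft f κ :=
    fun j => dft_multiplier (by simp [map_ofNat]) f κ
  unfold lap eig
  rw [dft_sum, Finset.sum_apply]
  simp_rw [h, ← Finset.sum_mul]
  push_cast
  rw [Finset.sum_neg_distrib, Finset.mul_sum]

theorem dft_L (a : ℝ) (f : GridFn d K) (κ : Fin d → ZMod (2 * K + 1)) :
    dft (L a f) κ = ((a + eig (rep κ) ^ 2 : ℝ) : ℂ) * dft f κ := by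
  unfold L
  rw [dft_add, dft_smul, Pi.add_apply, Pi.smul_apply, smul_eq_mul, dft_lap, dft_lap]
  push_cast
  ring

theorem dft_sqrtL (a : ℝ) (f : GridFn d K) (κ : Fin d → ZMod (2 * K + 1)) :
    dft (sqrtL a f) κ = ((Real.sqrt (a + eig (rep κ) ^ 2) : ℝ) : ℂ) * dft f κ :=
  dft_multiplier (by simp [eig]) f κ

theorem sqrtL_add (a : ℝ) (f g : GridFn d K) : sqrtL a (f + g) = sqrtL a f + sqrtL a g := by
  apply dft_injective
  funext κ
  simp only [dft_add, dft_sqrtL, Pi.add_apply]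
  ring

theorem sqrtL_smul (a c : ℝ) (f : GridFn d K) : sqrtL a (c • f) = c • sqrtL a f := by
  apply dft_injective
  funext κ
  simp only [dft_smul, dft_sqrtL, Pi.smul_apply, smul_eq_mul]
  ring

theorem sqrtL_sub (a : ℝ) (f g : GridFn d K) : sqrtL a (f - g) = sqrtL a f - sqrtL a g := by
  rw [sub_eq_add_neg, ← neg_one_smul ℝ g, sqrtL_add, sqrtL_smul, neg_one_smul, ← sub_eq_add_neg]

/-! ### The discrete inner product and the operators of the scheme. -/

theorem ip_add_right (f g h : GridFn d K) : ip f (g + h) = ip f g + ip f h := by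
  simp [ip, mul_add, Finset.sum_add_distrib]

theorem ip_smul_right (c : ℝ) (f g : GridFn d K) : ip f (c • g) = c * ip f g := by
  simp only [ip, Pi.smul_apply, smul_eq_mul, mul_left_comm _ c, ← Finset.mul_sum]

theorem ip_comm (f g : GridFn d K) : ip f g = ip g f := by
  simp [ip, mul_comm]

theorem ip_self_nonneg (f : GridFn d K) : 0 ≤ ip f f := by
  rw [ip_self_eq_sum_normSq]
  positivity

theorem norm2_sq (f : GridFn d K) : norm2 f ^ 2 = ip f f :=
  Real.sq_sqrt (ip_self_nonneg f)

theorem ip_lap_self_nonpos (f : GridFn d K) : ip (lap f) f ≤ 0 := by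
  have h := ip_eq_sum_dft (lap f) f
  simp_rw [dft_lap, mul_assoc, Complex.mul_conj'] at h
  have h' : ip (lap f) f = ∑ κ, -eig (rep κ) * ‖dft f κ‖ ^ 2 := by exact_mod_cast h
  rw [h']
  refine Finset.sum_nonpos fun κ _ => ?_
  have : 0 ≤ eig (rep κ) := by unfold eig; positivity
  nlinarith [sq_nonneg ‖dft f κ‖]

theorem ip_L {a : ℝ} (ha : 0 ≤ a) (f g : GridFn d K) :
    ip f (L a g) = ip (sqrtL a f) (sqrtL a g) := by
  have h : (ip f (L a g) : ℂ) = ip (sqrtL a f) (sqrtL a g) := by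
    rw [ip_eq_sum_dft, ip_eq_sum_dft]
    refine Finset.sum_congr rfl fun κ _ => ?_
    rw [dft_L, dft_sqrtL, dft_sqrtL, map_mul, map_mul, Complex.conj_ofReal, Complex.conj_ofReal]
    have hs : a + eig (rep κ) ^ 2 = √(a + eig (rep κ) ^ 2) * √(a + eig (rep κ) ^ 2) :=
      (Real.mul_self_sqrt (by positivity)).symm
    conv_lhs => rw [hs]
    push_cast
    ring
  exact_mod_cast h

/-- Turns the bound on the modified energy into one on both quadratic terms of `energy`. -/
theorem ip_sqrtL_self {a : ℝ} (ha : 0 ≤ a) (f : GridFn d K) :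
    ip (sqrtL a f) (sqrtL a f) = a * ip f f + ip (lap f) (lap f) := by
  simp only [ip_self_eq_sum_normSq, dft_sqrtL, dft_lap, Finset.mul_sum, ← Finset.sum_add_distrib,
    norm_mul, norm_neg, Complex.norm_real, Real.norm_eq_abs, mul_pow, sq_abs]
  refine Finset.sum_congr rfl fun κ _ => ?_
  rw [Real.sq_sqrt (by positivity)]
  ring

/-! ### Decay of the modified energy. -/

/-- The lower bound for the BDF2 difference tested with the newest value. -/
theorem bdf_mul_ge (u : ℤ → ℝ) (n : ℤ) :
    1 / 4 * (u (n + 1) ^ 2 + (2 * u (n + 1) - u n) ^ 2)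
      - 1 / 4 * (u n ^ 2 + (2 * u n - u (n - 1)) ^ 2) ≤ bdf u n * u (n + 1) := by
  simp only [bdf, smul_eq_mul]
  -- The two sides differ by exactly a quarter of this square.
  nlinarith [sq_nonneg (u (n + 1) - 2 * u n + u (n - 1))]

theorem ip_bdf_ge (u : ℤ → GridFn d K) (n : ℤ) :
    1 / 4 * (ip (u (n + 1)) (u (n + 1))
        + ip ((2 : ℝ) • u (n + 1) - u n) ((2 : ℝ) • u (n + 1) - u n))
      - 1 / 4 * (ip (u n) (u n) + ip ((2 : ℝ) • u n - u (n - 1)) ((2 : ℝ) • u n - u (n - 1)))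
      ≤ ip (bdf u n) (u (n + 1)) := by
  have hm : 0 ≤ mesh K ^ d := (pow_pos (mesh_pos K) d).le
  have h := mul_le_mul_of_nonneg_left
    (Finset.sum_le_sum fun x (_ : x ∈ Finset.univ) => bdf_mul_ge (fun m => u m x) n) hm
  refine le_trans (le_of_eq ?_) (h.trans (le_of_eq ?_))
  · simp only [ip, Finset.sum_sub_distrib, Finset.sum_add_distrib, ← Finset.mul_sum,
      Pi.sub_apply, Pi.smul_apply, smul_eq_mul, ← pow_two]
    ring
  · simp [ip, bdf]

theorem sqrtL_bdf (a : ℝ) (φ : ℤ → GridFn d K) (n : ℤ) :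
    sqrtL a (bdf φ n) = bdf (fun m => sqrtL a (φ m)) n := by
  simp only [bdf, sqrtL_add, sqrtL_sub, sqrtL_smul]

theorem modifiedEnergy_eq (a : ℝ) (φ ψ : GridFn d K) (r s : ℝ) :
    modifiedEnergy a φ ψ r s =
      1 / 4 * (ip (sqrtL a φ) (sqrtL a φ) + ip ((2 : ℝ) • sqrtL a φ - sqrtL a ψ)
        ((2 : ℝ) • sqrtL a φ - sqrtL a ψ)) + 1 / 2 * (r ^ 2 + (2 * r - s) ^ 2) := by
  simp only [modifiedEnergy, norm2_sq, sqrtL_sub, sqrtL_smul, sq_abs]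

/-- The modified energy does not increase along a solution of the scheme. -/
theorem IsSAVSolution.modifiedEnergy_step {a dt : ℝ} (ha : 0 ≤ a) (hdt : 0 < dt)
    {φ : ℤ → GridFn d K} {r : ℤ → ℝ} (hs : IsSAVSolution a dt φ r) {n : ℤ} (hn : 0 ≤ n) :
    modifiedEnergy a (φ (n + 1)) (φ n) (r (n + 1)) (r n) ≤
      modifiedEnergy a (φ n) (φ (n - 1)) (r n) (r (n - 1)) := by
  have hφ := hs.phi_step n hn
  have hr := hs.r_step n hn
  set P := nonlinPot (extrap φ n)
  set s := Real.sqrt (nonlinEnergy (extrap φ n))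
  have h1 := ip_lap_self_nonpos ((r (n + 1) / s) • P + L a (φ (n + 1)))
  rw [← hφ, ip_add_right, ip_smul_right, ip_comm _ P, ip_smul_right, ip_comm _ (L a _),
    ip_smul_right, ip_comm (L a _), ip_L ha, sqrtL_bdf] at h1
  rw [ip_smul_right] at hr
  have h2 := ip_bdf_ge (fun m => sqrtL a (φ m)) n
  have h3 := bdf_mul_ge r n
  rw [modifiedEnergy_eq, modifiedEnergy_eq]
  have hdt' : 0 < 1 / dt := by positivity
  -- The coupling term is the `r` equation times `2 r^{n+1}`. The identity also holds for `s = 0`,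
  -- where both sides vanish, so no lower bound on `nonlinEnergy` is needed.
  have h4 : r (n + 1) / s * (1 / dt * ip P (bdf φ n)) = 1 / dt * (2 * (bdf r n * r (n + 1))) := by
    have : r (n + 1) / s * (1 / dt * ip P (bdf φ n)) =
        2 * r (n + 1) * (1 / (2 * s) * (1 / dt * ip P (bdf φ n))) := by
      rw [one_div (2 * s), mul_inv, div_eq_mul_inv]
      ring
    rw [this, ← hr]
    ring
  rw [h4, ← mul_add] at h1
  have h5 := nonpos_of_mul_nonpos_right h1 hdt'
  linarith

theorem IsSAVSolution.modifiedEnergy_le {a dt : ℝ} (ha : 0 ≤ a) (hdt : 0 < dt)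
    {φ : ℤ → GridFn d K} {r : ℤ → ℝ} (hs : IsSAVSolution a dt φ r) {m : ℤ} (hm : 0 ≤ m) :
    modifiedEnergy a (φ m) (φ (m - 1)) (r m) (r (m - 1)) ≤
      modifiedEnergy a (φ 0) (φ (-1)) (r 0) (r (-1)) := by
  induction m, hm using Int.leInduction with
  | base => simp
  | succ n hn ih =>
    rw [add_sub_cancel_right]
    exact (hs.modifiedEnergy_step ha hdt hn).trans ih

/-! ### The discrete embedding of `H¹` into `L⁴`. -/

/-- `|k|²` for the representative `k ∈ {-K, …, K}^d` of a class of frequencies. -/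
def repSq (κ : Fin d → ZMod (2 * K + 1)) : ℝ := ∑ j, (rep κ j : ℝ) ^ 2

theorem repSq_nonneg (κ : Fin d → ZMod (2 * K + 1)) : 0 ≤ repSq κ := by
  unfold repSq; positivity

theorem repSq_eq_zero {κ : Fin d → ZMod (2 * K + 1)} : repSq κ = 0 ↔ κ = 0 := by
  unfold repSq
  rw [Finset.sum_eq_zero_iff_of_nonneg (fun _ _ => sq_nonneg _)]
  simp [rep, funext_iff]

theorem one_le_repSq {κ : Fin d → ZMod (2 * K + 1)} (h : κ ≠ 0) : 1 ≤ repSq κ := by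
  have h1 : repSq κ ≠ 0 := fun h' => h (repSq_eq_zero.1 h')
  have h2 := repSq_nonneg κ
  have h3 : repSq κ = ((∑ j, (rep κ j) ^ 2 : ℤ) : ℝ) := by simp [repSq]
  rw [h3] at h1 h2 ⊢
  norm_cast at h1 h2 ⊢
  omega

/-- In dimension less than four, the sums of `|k|⁻⁴` over `0 ≠ k ∈ {-K, …, K}^d` are bounded
independently of `K`. -/
theorem exists_sum_repSq_inv_sq_le (hd : d < 4) :
    ∃ S : ℝ, 0 ≤ S ∧ ∀ K : ℕ, ∑ κ : Fin d → ZMod (2 * K + 1), ((repSq κ)⁻¹) ^ 2 ≤ S := by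
  let b := (EuclideanSpace.basisFun (Fin d) ℝ).toBasis
  let b' := b.restrictScalars ℤ
  have key := ZLattice.sum_piFinset_Icc_rpow_le b' (d := d) (by simp)
  have hr : (-4 : ℝ) < -d := by
    have : (d : ℝ) < 4 := by exact_mod_cast hd
    linarith
  refine ⟨max _ 0, le_max_right _ _, fun K => le_trans (le_of_eq ?_)
    ((key K (-4) hr).trans (le_max_left _ _))⟩
  change _ = ∑ p ∈ freqs d K, ‖∑ i, p i • b' i‖ ^ (-4 : ℝ)
  rw [sum_freqs]
  refine Finset.sum_congr rfl fun κ _ => ?_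
  have h1 : ‖∑ i, rep κ i • b' i‖ ^ 2 = repSq κ := by
    have : ((∑ i, rep κ i • b' i : _) : EuclideanSpace ℝ (Fin d)) =
        WithLp.toLp 2 (fun i => (rep κ i : ℝ)) := by
      have hb : ∀ i, ((b' i : _) : EuclideanSpace ℝ (Fin d)) = b i :=
        fun i => Module.Basis.restrictScalars_apply ℤ b i
      rw [← Submodule.subtype_apply, map_sum]
      simp only [map_zsmul, Submodule.subtype_apply, hb]
      ext j
      simp [b, Pi.single_apply]
    rw [Submodule.coe_norm, this, EuclideanSpace.norm_sq_eq]
    simp [repSq]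
  -- Since `0⁻¹ = 0`, the zero frequency contributes nothing on either side.
  rw [← h1, Real.rpow_neg (norm_nonneg _), inv_pow, ← pow_mul]
  congr 1
  norm_cast

/-- The embedding of `H¹` into `L⁴` for grid functions of mean zero: `h^d ∑ f⁴` is at most the sum
of `|k|⁻⁴` times the square of the sum of `|k|² |f̂_k|²`. -/
theorem ip_mul_self_le (f : GridFn d K) (h0 : dft f 0 = 0) :
    ip (f * f) (f * f) ≤ (∑ κ : Fin d → ZMod (2 * K + 1), ((repSq κ)⁻¹) ^ 2) *
      (∑ κ, repSq κ * ‖dft f κ‖ ^ 2) ^ 2 := by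
  set S := ∑ κ : Fin d → ZMod (2 * K + 1), ((repSq κ)⁻¹) ^ 2
  set A : (Fin d → ZMod (2 * K + 1)) → ℝ := fun κ => repSq κ * ‖dft f κ‖ ^ 2
  -- Mean zero enters here: at `κ = 0` the right side vanishes.
  have hA : ∀ κ, ‖dft f κ‖ ^ 2 = A κ * (repSq κ)⁻¹ := by
    intro κ
    by_cases h : κ = 0
    · subst h; simp [A, h0]
    · have := one_le_repSq h
      simp only [A]
      field_simp
  have hA0 : ∀ κ, 0 ≤ A κ := fun κ => mul_nonneg (repSq_nonneg κ) (sq_nonneg _)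
  have hw0 : ∀ κ : Fin d → ZMod (2 * K + 1), 0 ≤ (repSq κ)⁻¹ :=
    fun κ => inv_nonneg.2 (repSq_nonneg κ)
  -- By `xy ≤ x²/2 + y²/2` and invariance under `l ↦ κ - l`.
  have hw : ∀ κ : Fin d → ZMod (2 * K + 1), ∑ l, (repSq l)⁻¹ * (repSq (κ - l))⁻¹ ≤ S := by
    intro κ
    have h1 : ∑ l, ((repSq (κ - l))⁻¹) ^ 2 = S :=
      Fintype.sum_equiv (Equiv.subLeft κ) _ _ (fun _ => rfl)
    have h2 : ∑ l, (repSq l)⁻¹ * (repSq (κ - l))⁻¹ ≤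
        ∑ l, (((repSq l)⁻¹) ^ 2 / 2 + ((repSq (κ - l))⁻¹) ^ 2 / 2) :=
      Finset.sum_le_sum fun l _ => by
        nlinarith [sq_nonneg ((repSq l)⁻¹ - (repSq (κ - l))⁻¹)]
    rw [Finset.sum_add_distrib, ← Finset.sum_div, ← Finset.sum_div, h1] at h2
    change _ ≤ S / 2 + S / 2 at h2
    linarith
  have hconv : ∀ κ, ‖dft (f * f) κ‖ ^ 2 ≤ S * ∑ l, A l * A (κ - l) := by
    intro κ
    have h1 : ‖dft (f * f) κ‖ ≤ ∑ l, ‖dft f l‖ * ‖dft f (κ - l)‖ := by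
      rw [dft_mul]
      exact (norm_sum_le _ _).trans (le_of_eq (by simp))
    have h2 : (∑ l, ‖dft f l‖ * ‖dft f (κ - l)‖) ^ 2 ≤
        (∑ l, A l * A (κ - l)) * ∑ l, (repSq l)⁻¹ * (repSq (κ - l))⁻¹ := by
      refine Finset.sum_sq_le_sum_mul_sum_of_sq_le_mul _
        (fun l _ => mul_nonneg (hA0 _) (hA0 _)) (fun l _ => mul_nonneg (hw0 _) (hw0 _)) ?_
      intro l _
      rw [mul_pow, hA, hA]
      exact le_of_eq (mul_mul_mul_comm _ _ _ _)
    calc ‖dft (f * f) κ‖ ^ 2 ≤ (∑ l, ‖dft f l‖ * ‖dft f (κ - l)‖) ^ 2 := by gcongr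
      _ ≤ _ := h2
      _ ≤ (∑ l, A l * A (κ - l)) * S :=
        mul_le_mul_of_nonneg_left (hw κ)
          (Finset.sum_nonneg fun l _ => mul_nonneg (hA0 _) (hA0 _))
      _ = _ := mul_comm _ _
  have hsum : ∑ κ, ∑ l, A l * A (κ - l) = (∑ κ, A κ) ^ 2 := by
    rw [Finset.sum_comm, pow_two, Finset.sum_mul]
    refine Finset.sum_congr rfl fun l _ => ?_
    rw [← Finset.mul_sum]
    congr 1
    exact Fintype.sum_equiv (Equiv.subRight l) _ _ (fun _ => rfl)
  rw [ip_self_eq_sum_normSq, ← hsum, Finset.mul_sum]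
  exact Finset.sum_le_sum fun κ _ => hconv κ

theorem eig_rep (κ : Fin d → ZMod (2 * K + 1)) : eig (rep κ) = 4 * Real.pi ^ 2 * repSq κ := rfl

/-- The gradient of a grid function in `L⁴`, bounded by its Laplacian in `L²`. -/
theorem ip_D_mul_self_le (f : GridFn d K) (j : Fin d) :
    ip (D j f * D j f) (D j f * D j f) ≤
      (∑ κ : Fin d → ZMod (2 * K + 1), ((repSq κ)⁻¹) ^ 2) * ip (lap f) (lap f) ^ 2 := by
  refine (ip_mul_self_le (D j f) (by simp [dft_D, rep_zero])).trans ?_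
  gcongr
  · exact Finset.sum_nonneg fun κ _ => mul_nonneg (repSq_nonneg κ) (sq_nonneg _)
  rw [ip_self_eq_sum_normSq]
  refine Finset.sum_le_sum fun κ _ => ?_
  have h1 : ‖dft (D j f) κ‖ ^ 2 = 4 * Real.pi ^ 2 * (rep κ j : ℝ) ^ 2 * ‖dft f κ‖ ^ 2 := by
    rw [dft_D]
    simp only [norm_mul, mul_pow, Complex.norm_I, Complex.norm_real, Complex.norm_intCast,
      Real.norm_eq_abs, sq_abs, Complex.norm_ofNat]
    ring
  have h2 : ‖dft (lap f) κ‖ ^ 2 = (4 * Real.pi ^ 2 * repSq κ) ^ 2 * ‖dft f κ‖ ^ 2 := by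
    rw [dft_lap, eig_rep, norm_mul, mul_pow, norm_neg, Complex.norm_real, Real.norm_eq_abs, sq_abs]
  have h3 : (rep κ j : ℝ) ^ 2 ≤ repSq κ :=
    Finset.single_le_sum (f := fun i => (rep κ i : ℝ) ^ 2) (fun _ _ => sq_nonneg _)
      (Finset.mem_univ j)
  have h4 := repSq_nonneg κ
  -- The Laplacian carries one more factor `4π²` than the gradient; it is simply discarded.
  have h5 : 1 ≤ 4 * Real.pi ^ 2 := by nlinarith [Real.pi_gt_three]
  rw [h1, h2]
  calc repSq κ * (4 * Real.pi ^ 2 * (rep κ j : ℝ) ^ 2 * ‖dft f κ‖ ^ 2)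
      ≤ repSq κ * (4 * Real.pi ^ 2 * repSq κ * ‖dft f κ‖ ^ 2) := by gcongr
    _ = 1 * (4 * Real.pi ^ 2 * repSq κ ^ 2 * ‖dft f κ‖ ^ 2) := by ring
    _ ≤ (4 * Real.pi ^ 2) * (4 * Real.pi ^ 2 * repSq κ ^ 2 * ‖dft f κ‖ ^ 2) := by gcongr
    _ = _ := by ring

theorem normP_four_pow (f : GridFn d K) : normP 4 f ^ 4 = ip (f * f) (f * f) := by
  have hm : 0 ≤ mesh K ^ d := (pow_pos (mesh_pos K) d).le
  unfold normP
  rw [← Real.rpow_natCast, ← Real.rpow_mul (by positivity)]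
  norm_num
  unfold ip
  congr 1
  refine Finset.sum_congr rfl fun x _ => ?_
  have : |f x| ^ 4 = (|f x| ^ 2) ^ 2 := by ring
  rw [this, sq_abs]
  simp only [Pi.mul_apply]
  ring

theorem normP_gradLen_pow_le (f : GridFn d K) :
    normP 4 (gradLen f) ^ 4 ≤ d * ∑ j, ip (D j f * D j f) (D j f * D j f) := by
  have hm : 0 ≤ mesh K ^ d := (pow_pos (mesh_pos K) d).le
  rw [normP_four_pow]
  unfold ip
  rw [← Finset.mul_sum, Finset.sum_comm, mul_left_comm, Finset.mul_sum Finset.univ _ (d : ℝ)]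
  refine mul_le_mul_of_nonneg_left (Finset.sum_le_sum fun x _ => ?_) hm
  have h1 : gradLen f x * gradLen f x = ∑ j, D j f x ^ 2 :=
    Real.mul_self_sqrt (Finset.sum_nonneg fun _ _ => sq_nonneg _)
  simp only [Pi.mul_apply, h1]
  -- Cauchy–Schwarz over the `d` components gives the factor `d`.
  have h2 := sq_sum_le_card_mul_sum_sq (s := Finset.univ) (f := fun j => D j f x ^ 2)
  simp only [Finset.card_univ, Fintype.card_fin] at h2
  simpa only [pow_two] using h2

end SPFC

end

/-! ### The uniform energy bound. -/

theorem mainTheorem4 (d : ℕ) (hd : d = 2 ∨ d = 3) (C₀ : ℝ) :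
    ∃ Cstar : ℝ, 0 < Cstar ∧
      ∀ (a : ℝ), 0 < a → ∀ (K : ℕ) (dt : ℝ), 0 < dt →
        ∀ (φ : ℤ → SPFC.GridFn d K) (r : ℤ → ℝ),
          SPFC.IsSAVSolution a dt φ r →
          SPFC.modifiedEnergy a (φ 0) (φ (-1)) (r 0) (r (-1)) ≤ C₀ →
          ∀ m : ℤ, 1 ≤ m → SPFC.energy a (φ m) ≤ Cstar := by
  obtain ⟨S, hS0, hS⟩ := SPFC.exists_sum_repSq_inv_sq_le (d := d) (by omega)
  -- One `d` comes from Cauchy–Schwarz, the other from summing over components; `2|C₀|` covers the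
  -- quadratic part, half of `4C₀`; the `1` only makes the constant positive.
  refine ⟨1 / 4 * (d * (d * (S * (4 * C₀) ^ 2))) + 2 * |C₀| + 1, by positivity, ?_⟩
  intro a ha K dt hdt φ r hs h0 m hm
  have hE := (hs.modifiedEnergy_le ha.le hdt (by omega : 0 ≤ m)).trans h0
  rw [SPFC.modifiedEnergy_eq] at hE
  have h1 : a * SPFC.ip (φ m) (φ m) + SPFC.ip (SPFC.lap (φ m)) (SPFC.lap (φ m)) ≤ 4 * C₀ := by
    rw [← SPFC.ip_sqrtL_self ha.le]
    have h2 := SPFC.ip_self_nonneg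
      ((2 : ℝ) • SPFC.sqrtL a (φ m) - SPFC.sqrtL a (φ (m - 1)))
    nlinarith [sq_nonneg (r m), sq_nonneg (2 * r m - r (m - 1))]
  have hL0 := SPFC.ip_self_nonneg (SPFC.lap (φ m))
  have ha0 := mul_nonneg ha.le (SPFC.ip_self_nonneg (φ m))
  have hj : ∀ j, SPFC.ip (SPFC.D j (φ m) * SPFC.D j (φ m)) (SPFC.D j (φ m) * SPFC.D j (φ m)) ≤
      S * (4 * C₀) ^ 2 := by
    intro j
    refine (SPFC.ip_D_mul_self_le (φ m) j).trans ?_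
    gcongr
    · exact hS K
    · linarith
  have h4 : SPFC.normP 4 (SPFC.gradLen (φ m)) ^ 4 ≤ d * (d * (S * (4 * C₀) ^ 2)) := by
    refine (SPFC.normP_gradLen_pow_le (φ m)).trans ?_
    gcongr
    refine (Finset.sum_le_sum fun j _ => hj j).trans (le_of_eq ?_)
    simp
  -- The gradient term enters `energy` with a minus sign and is dropped.
  have hg := sq_nonneg (SPFC.norm2 (SPFC.gradLen (φ m)))
  unfold SPFC.energy
  rw [SPFC.norm2_sq (φ m), SPFC.norm2_sq (SPFC.lap (φ m))]
  have := le_abs_self C₀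
  linarith
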